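/- For a positive integer $k$ and real $x>0$ put $$F_{2k+1}(x)=\sum_{n=1}^{\infty}\frac{n^{-2k-1}}{e^{2nx}-1}.$$ Let $B_n$ be the Bernoulli numbers, $\zeta$ the Riemann zeta function, and for an integer $x$ and $m\ge 0$ let $\binom{x}{m}=x(x-1)\cdots(x-m+1)/m!$. The series converges for every $x>0$ and $F_{2k+1}$ is infinitely differentiable on $(0,\infty)$. Let $a,b>0$ with $ab=\pi^2$ and let $k\ge 1$ be an integer. Then for every integer $m\ge 1$ $$(-1)^k\binom{2k-1+m}{m}\Big(\frac{\pi}{a}\Big)^{2k}\zeta(2k+1)+(2\pi)^{2k+1}\sum_{q=0}^{k+1}(-1)^{k+q}\frac{B_{2q}B_{2(k+1-q)}}{(2q)!\,(2(k+1-q))!}\binom{2(q-1)+m}{m}\Big(\frac{\pi}{a}\Big)^{2q-1}$$ $$=2\,\frac{b^m}{m!}F_{2k+1}^{(m)}(b)+2\sum_{r=1}^{m-1}\frac{1}{r!}\binom{m-1}{r-1}b^rF_{2k+1}^{(r)}(b)+2(-1)^k\Big(\frac{\pi}{a}\Big)^{2k}\sum_{r=0}^{m}\frac{(-1)^{r+1}}{r!}\binom{2k-1+m-r}{2k-1}a^rF_{2k+1}^{(r)}(a).$$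 The formula of order $m=0$ that these identities extend is Ramanujan's formula $$a^{-k}\Big(\tfrac12\zeta(2k+1)+F_{2k+1}(a)\Big)=(-b)^{-k}\Big(\tfrac12\zeta(2k+1)+F_{2k+1}(b)\Big)-2^{2k}\sum_{j=0}^{k+1}\frac{(-1)^jB_{2j}B_{2k+2-2j}}{(2j)!\,(2k+2-2j)!}\,a^{k+1-j}b^j ,$$ which also holds. -/

import Mathlib

/-- The `n`-th term (indexed from `n = 0`, standing for the integer `n + 1`) of the series
`F_s(x) = ∑_{n ≥ 1} n^{-s} / (e^{2 n x} - 1)`. -/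
noncomputable def lambertTerm (s : ℕ) (x : ℝ) (n : ℕ) : ℝ :=
  (((n : ℝ) + 1) ^ s)⁻¹ / (Real.exp (2 * ((n : ℝ) + 1) * x) - 1)

/-- `F_s(x) = ∑_{n ≥ 1} n^{-s} / (e^{2 n x} - 1)`, considered for `x > 0`. -/
noncomputable def lambertF (s : ℕ) (x : ℝ) : ℝ :=
  ∑' n : ℕ, lambertTerm s x n

/-! Order zero comes from the double series `S(t) = ∑ n^{-2k} / (m² + n² t²)`. Summing over `m` by
the cotangent expansion expresses `ζ(2k+1) + 2 F(πt)` through `S(t)` and `ζ(2k+2)`. Partial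
fractions trade `n^{-2k}` for `m^{-2k}` at the cost of products of even zeta values; exchanging `m`
and `n` then relates `S(t)` to `S(1/t)` (`tsum_latticeTerm_inv`), which is Ramanujan's formula.

For order `m`, write that formula in `x`, with `F(x)` on one side of the inversion and `x^{2k}
F(π²/x)` on the other, and apply `θ (θ + 1) ⋯ (θ + m - 1) / m!`, where `θ = x d/dx`. Powers are
eigenfunctions, which produces the binomials, and constants are killed. The operator is encoded by
the one-step relation `IsEulerChain`, which determines every order from order zero
(`eq_of_eq_zero`); closed forms are checked through coefficient recurrences
(`sum_range_of_recurrence`). -/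

/-! ### Convergence and smoothness of the Lambert series. -/

lemma summable_inv_succ_pow {s : ℕ} (hs : 2 ≤ s) :
    Summable fun n : ℕ => (((n : ℝ) + 1) ^ s)⁻¹ := by
  have h := (summable_nat_add_iff 1).2 (Real.summable_nat_pow_inv.2 (by omega : 1 < s))
  simpa using h

lemma norm_lambertTerm_complex_le {d : ℝ} (hd : 0 < d) (s n : ℕ) {z : ℂ} (hz : d < z.re) :
    ‖(((n : ℂ) + 1) ^ s)⁻¹ / (Complex.exp (2 * ((n : ℂ) + 1) * z) - 1)‖ ≤
      (((n : ℝ) + 1) ^ s)⁻¹ * (Real.exp (2 * d) - 1)⁻¹ := by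
  have h1 : 0 < Real.exp (2 * d) - 1 := by
    have := Real.add_one_lt_exp (x := 2 * d) (by positivity)
    linarith
  have h2 : Real.exp (2 * d) - 1 ≤ ‖Complex.exp (2 * ((n : ℂ) + 1) * z) - 1‖ := by
    have h3 : Real.exp (2 * d) ≤ ‖Complex.exp (2 * ((n : ℂ) + 1) * z)‖ := by
      rw [Complex.norm_exp, Real.exp_le_exp]
      have : (2 * ((n : ℂ) + 1) * z).re = 2 * ((n : ℝ) + 1) * z.re := by
        have h : (2 * ((n : ℂ) + 1)) = ((2 * ((n : ℝ) + 1) : ℝ) : ℂ) := by push_cast; ring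
        rw [h, Complex.re_ofReal_mul]
      rw [this]
      nlinarith [(Nat.cast_nonneg n : (0 : ℝ) ≤ n), mul_nonneg (Nat.cast_nonneg n : (0 : ℝ) ≤ n)
        (hd.trans hz).le]
    have h4 := norm_sub_norm_le (Complex.exp (2 * ((n : ℂ) + 1) * z)) 1
    rw [norm_one] at h4
    linarith
  have h5 : ‖(n : ℂ) + 1‖ = (n : ℝ) + 1 := by
    have : (n : ℂ) + 1 = ((n + 1 : ℕ) : ℂ) := by push_cast; ring
    rw [this, Complex.norm_natCast]; push_cast; ring
  rw [div_eq_mul_inv, norm_mul, norm_inv, norm_inv, norm_pow, h5]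
  gcongr

lemma ofReal_lambertTerm (s n : ℕ) (x : ℝ) :
    ((lambertTerm s x n : ℝ) : ℂ) =
      (((n : ℂ) + 1) ^ s)⁻¹ / (Complex.exp (2 * ((n : ℂ) + 1) * x) - 1) := by
  simp [lambertTerm]

lemma summable_lambertTerm {s : ℕ} (hs : 2 ≤ s) {x : ℝ} (hx : 0 < x) :
    Summable (lambertTerm s x) := by
  refine Summable.of_norm_bounded
    ((summable_inv_succ_pow hs).mul_right (Real.exp (2 * (x / 2)) - 1)⁻¹) fun n => ?_
  have h := norm_lambertTerm_complex_le (half_pos hx) s n (z := (x : ℂ))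
    (by simpa using half_lt_self hx)
  rwa [← ofReal_lambertTerm, Complex.norm_real] at h

/-- The series extends holomorphically to a half-plane, where one uniform bound suffices; smoothness
follows without estimating termwise derivatives. -/
lemma contDiffAt_lambertF {s : ℕ} (hs : 2 ≤ s) {x : ℝ} (hx : 0 < x) :
    ContDiffAt ℝ (⊤ : ℕ∞) (lambertF s) x := by
  set F : ℂ → ℂ := fun z => ∑' n : ℕ,
    (((n : ℂ) + 1) ^ s)⁻¹ / (Complex.exp (2 * ((n : ℂ) + 1) * z) - 1) with hF
  have hopen : IsOpen {z : ℂ | x / 2 < z.re} := isOpen_lt continuous_const Complex.continuous_re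
  have hdiff : DifferentiableOn ℂ F {z : ℂ | x / 2 < z.re} := by
    refine Complex.differentiableOn_tsum_of_summable_norm
      ((summable_inv_succ_pow hs).mul_right (Real.exp (2 * (x / 2)) - 1)⁻¹) (fun n => ?_) hopen
      (fun n z hz => norm_lambertTerm_complex_le (half_pos hx) s n hz)
    intro z hz
    refine (DifferentiableAt.div (by fun_prop) (by fun_prop) ?_).differentiableWithinAt
    intro h0
    have h1 : ‖Complex.exp (2 * ((n : ℂ) + 1) * z)‖ = 1 := by rw [sub_eq_zero.1 h0, norm_one]
    have h2 : (2 * ((n : ℂ) + 1) * z).re = 2 * ((n : ℝ) + 1) * z.re := by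
      have h : (2 * ((n : ℂ) + 1)) = ((2 * ((n : ℝ) + 1) : ℝ) : ℂ) := by push_cast; ring
      rw [h, Complex.re_ofReal_mul]
    rw [Complex.norm_exp, Real.exp_eq_one_iff, h2] at h1
    have h3 : 0 < z.re := (half_pos hx).trans hz
    have : 0 < 2 * ((n : ℝ) + 1) * z.re := by positivity
    exact this.ne' h1
  have hc : ContDiffAt ℂ (⊤ : ℕ∞) F (x : ℂ) :=
    (hdiff.contDiffOn hopen).contDiffAt (hopen.mem_nhds (by simpa using half_lt_self hx))
  have h := hc.real_of_complex
  have he : (fun y : ℝ => (F y).re) = lambertF s := by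
    funext y
    have : F y = ((lambertF s y : ℝ) : ℂ) := by
      simp only [hF, lambertF, Complex.ofReal_tsum, ofReal_lambertTerm]
    rw [this, Complex.ofReal_re]
  rwa [he] at h

lemma hasDerivAt_iteratedDeriv_lambertF {s : ℕ} (hs : 2 ≤ s) (r : ℕ) {x : ℝ} (hx : 0 < x) :
    HasDerivAt (iteratedDeriv r (lambertF s)) (iteratedDeriv (r + 1) (lambertF s) x) x := by
  rw [iteratedDeriv_succ]
  have h := ContDiffWithinAt.differentiableWithinAt_iteratedDerivWithin (s := Set.univ) (m := r)
    ((contDiffAt_lambertF hs hx).contDiffWithinAt) (by exact_mod_cast WithTop.coe_lt_top r)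
    (by simp)
  rw [iteratedDerivWithin_univ, differentiableWithinAt_univ] at h
  exact h.hasDerivAt

lemma HasSum.congr_of_eq {ι E : Type*} [AddCommMonoid E] [TopologicalSpace E] {f g : ι → E}
    {a b : E} (h : HasSum f a) (hf : ∀ i, g i = f i) (hb : b = a) : HasSum g b := by
  rwa [funext hf, hb]

/-! ### The double series and Ramanujan's formula. -/

/-- This is the Mittag-Leffler expansion of `π cot(πz)` at `z = iy`. -/
lemma hasSum_inv_sq_add_sq {y : ℝ} (hy : 0 < y) :
    HasSum (fun m : ℕ => (((m : ℝ) + 1) ^ 2 + y ^ 2)⁻¹)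
      ((Real.pi * (1 + 2 / (Real.exp (2 * Real.pi * y) - 1)) - 1 / y) / (2 * y)) := by
  have hyC : (y : ℂ) ≠ 0 := by exact_mod_cast hy.ne'
  have hz : (y : ℂ) * Complex.I ∈ Complex.integerComplement := by
    rintro ⟨n, hn⟩
    have := congrArg Complex.im hn
    simp at this
    exact hy.ne' this.symm
  have h := (summable_cotTerm hz).hasSum
  have hE : Real.exp (2 * Real.pi * y) - 1 ≠ 0 := by
    have := Real.add_one_lt_exp (x := 2 * Real.pi * y) (by positivity)
    have : 0 < 2 * Real.pi * y := by positivity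
    linarith
  have hcot : Complex.cot (Real.pi * (y * Complex.I)) =
      -Complex.I * ((1 + 2 / (Real.exp (2 * Real.pi * y) - 1) : ℝ) : ℂ) := by
    rw [Complex.cot_pi_eq_exp_ratio]
    have h1 : 2 * (Real.pi : ℂ) * Complex.I * (y * Complex.I) =
        ((-(2 * Real.pi * y) : ℝ) : ℂ) := by
      push_cast
      linear_combination (2 * (Real.pi : ℂ) * y) * Complex.I_mul_I
    rw [h1, ← Complex.ofReal_exp, Real.exp_neg]
    have hpos := (Real.exp_pos (2 * Real.pi * y)).ne'
    generalize Real.exp (2 * Real.pi * y) = e at hE hpos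
    have hE' : (e : ℂ) - 1 ≠ 0 := by exact_mod_cast hE
    have hpos' : (e : ℂ) ≠ 0 := by exact_mod_cast hpos
    push_cast
    have h2 : 1 - (e : ℂ)⁻¹ ≠ 0 := by
      rw [show 1 - (e : ℂ)⁻¹ = (e - 1) / e by field_simp]
      exact div_ne_zero hE' hpos'
    rw [div_eq_iff (mul_ne_zero Complex.I_ne_zero h2)]
    field_simp
    rw [Complex.I_sq]
    ring
  -- At `z = iy` a cotangent term is `2z/(z² - m²) = -2iy/(m² + y²)`, whence the factor `i/(2y)`.
  have h2 := h.mul_left (Complex.I / (2 * y))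
  rw [show (∑' n, cotTerm ((y : ℂ) * Complex.I) n) = _ from
    (cot_series_rep' hz).symm, hcot] at h2
  rw [← Complex.hasSum_ofReal]
  refine h2.congr_of_eq (fun m => ?_) ?_
  · have h3 : ((m : ℂ) + 1) ^ 2 + (y : ℂ) ^ 2 ≠ 0 := by
      have : ((m : ℝ) + 1) ^ 2 + y ^ 2 ≠ 0 := by positivity
      exact_mod_cast this
    have h4 : (y * Complex.I - ((m : ℂ) + 1)) * (y * Complex.I + ((m : ℂ) + 1)) =
        -(((m : ℂ) + 1) ^ 2 + (y : ℂ) ^ 2) := by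
      linear_combination (y : ℂ) ^ 2 * Complex.I_mul_I
    have h5 : (y * Complex.I - ((m : ℂ) + 1)) ≠ 0 := fun h0 => by
      rw [h0, zero_mul] at h4; exact h3 (neg_eq_zero.1 h4.symm)
    have h6 : (y * Complex.I + ((m : ℂ) + 1)) ≠ 0 := fun h0 => by
      rw [h0, mul_zero] at h4; exact h3 (neg_eq_zero.1 h4.symm)
    simp only [cotTerm]
    rw [div_add_div _ _ h5 h6, h4]
    push_cast
    field_simp
    linear_combination (2 * y : ℂ) * Complex.I_mul_I
  · push_cast
    rw [one_div ((y : ℂ) * Complex.I), mul_inv, Complex.inv_I]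
    generalize 1 + 2 / (Complex.exp (2 * Real.pi * y) - 1) = w
    linear_combination ((Real.pi * w - 1 / y) / (2 * y)) * Complex.I_mul_I

/-- The sum `∑ (n + 1)⁻ˢ`, that is, the value `ζ(s)`. -/
noncomputable def zetaSum (s : ℕ) : ℝ := ∑' n : ℕ, (((n : ℝ) + 1) ^ s)⁻¹

lemma hasSum_zetaSum {s : ℕ} (hs : 2 ≤ s) :
    HasSum (fun n : ℕ => (((n : ℝ) + 1) ^ s)⁻¹) (zetaSum s) :=
  (summable_inv_succ_pow hs).hasSum

lemma riemannZeta_eq_zetaSum {k : ℕ} (hk : 1 ≤ k) :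
    riemannZeta (2 * (k : ℂ) + 1) = ((zetaSum (2 * k + 1) : ℝ) : ℂ) := by
  have h := zeta_nat_eq_tsum_of_gt_one (k := 2 * k + 1) (by omega)
  push_cast at h
  have hr := (Real.summable_one_div_nat_pow.2 (by omega : 1 < 2 * k + 1)).tsum_eq_zero_add
  have hc : ∑' n : ℕ, 1 / (n : ℂ) ^ (2 * k + 1) =
      ((∑' n : ℕ, 1 / (n : ℝ) ^ (2 * k + 1) : ℝ) : ℂ) := by
    push_cast
    rfl
  rw [h, hc, hr, zetaSum]
  simp

/-- The normalised even Bernoulli number, equal to `ζ(2 j)` for every `j`. -/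
noncomputable def evenZeta (j : ℕ) : ℝ :=
  (-1) ^ (j + 1) * (2 * Real.pi) ^ (2 * j) * bernoulli (2 * j) / (2 * (2 * j).factorial)

/-- The value `ζ(0)` lets the two `ζ(2k+2)` terms become the end terms of the Bernoulli sum. -/
lemma evenZeta_zero : evenZeta 0 = -1 / 2 := by simp [evenZeta]

lemma zetaSum_even {j : ℕ} (hj : j ≠ 0) : zetaSum (2 * j) = evenZeta j := by
  have h := (hasSum_nat_add_iff' 1).2 (hasSum_zeta_nat hj)
  simp only [Finset.range_one, Finset.sum_singleton, Nat.cast_zero, Nat.cast_add, Nat.cast_one,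
    one_div] at h
  rw [zero_pow (by omega), inv_zero, sub_zero] at h
  rw [zetaSum, h.tsum_eq, evenZeta, mul_pow]
  obtain ⟨i, rfl⟩ := Nat.exists_eq_succ_of_ne_zero hj
  rw [show 2 * i.succ - 1 = 2 * i + 1 by omega, show 2 * i.succ = 2 * i + 1 + 1 by omega]
  rw [pow_succ (2 : ℝ) (2 * i + 1)]
  field_simp

/-- The general term of the double series `∑ n^{-2k} / (m² + n² t²)`. -/
noncomputable def latticeTerm (k : ℕ) (t : ℝ) (p : ℕ × ℕ) : ℝ :=
  (((p.1 : ℝ) + 1) ^ (2 * k))⁻¹ * (((p.2 : ℝ) + 1) ^ 2 + (((p.1 : ℝ) + 1) * t) ^ 2)⁻¹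

lemma summable_inv_pow_mul_inv_pow {r s : ℕ} (hr : 2 ≤ r) (hs : 2 ≤ s) :
    Summable fun p : ℕ × ℕ => (((p.1 : ℝ) + 1) ^ r)⁻¹ * (((p.2 : ℝ) + 1) ^ s)⁻¹ :=
  (summable_inv_succ_pow hr).mul_of_nonneg (summable_inv_succ_pow hs)
    (fun n => by positivity) (fun n => by positivity)

lemma summable_latticeTerm {k : ℕ} (hk : 1 ≤ k) (t : ℝ) : Summable (latticeTerm k t) := by
  refine Summable.of_nonneg_of_le (fun p => ?_) (fun p => ?_)
    (summable_inv_pow_mul_inv_pow (r := 2 * k) (s := 2) (by omega) le_rfl)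
  · unfold latticeTerm; positivity
  · unfold latticeTerm
    gcongr
    nlinarith [sq_nonneg (((p.1 : ℝ) + 1) * t)]

lemma zetaSum_add_two_mul_lambertF {k : ℕ} (hk : 1 ≤ k) {t : ℝ} (ht : 0 < t) :
    zetaSum (2 * k + 1) + 2 * lambertF (2 * k + 1) (Real.pi * t) =
      zetaSum (2 * k + 2) / (Real.pi * t) + 2 * t / Real.pi * ∑' p, latticeTerm k t p := by
  have hpi := Real.pi_pos
  have hrow : ∀ n : ℕ, HasSum (fun m => latticeTerm k t (n, m))
      (Real.pi / (2 * t) * (((n : ℝ) + 1) ^ (2 * k + 1))⁻¹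
        + Real.pi / t * lambertTerm (2 * k + 1) (Real.pi * t) n
        - 1 / (2 * t ^ 2) * (((n : ℝ) + 1) ^ (2 * k + 2))⁻¹) := fun n => by
    have hn : (0 : ℝ) < (n : ℝ) + 1 := by positivity
    refine ((hasSum_inv_sq_add_sq (mul_pos hn ht)).mul_left
      ((((n : ℝ) + 1) ^ (2 * k))⁻¹)).congr_of_eq (fun m => rfl) ?_
    unfold lambertTerm
    rw [show 2 * ((n : ℝ) + 1) * (Real.pi * t) = 2 * Real.pi * (((n : ℝ) + 1) * t) by ring]
    have hE : Real.exp (2 * Real.pi * (((n : ℝ) + 1) * t)) - 1 ≠ 0 := by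
      have h0 : 0 < 2 * Real.pi * (((n : ℝ) + 1) * t) := by positivity
      have := Real.add_one_lt_exp h0.ne'
      linarith
    generalize Real.exp (2 * Real.pi * (((n : ℝ) + 1) * t)) - 1 = e at hE
    rw [pow_succ _ (2 * k + 1), pow_succ _ (2 * k)]
    have hp : ((n : ℝ) + 1) ^ (2 * k) ≠ 0 := by positivity
    generalize ((n : ℝ) + 1) ^ (2 * k) = q at hp
    field_simp
  have h1 := (summable_latticeTerm hk t).hasSum.prod_fiberwise hrow
  have h2 := (((hasSum_zetaSum (s := 2 * k + 1) (by omega)).mul_left (Real.pi / (2 * t))).add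
    ((summable_lambertTerm (s := 2 * k + 1) (by omega) (mul_pos hpi ht)).hasSum.mul_left
      (Real.pi / t))).sub
    ((hasSum_zetaSum (s := 2 * k + 2) (by omega)).mul_left (1 / (2 * t ^ 2)))
  rw [h1.unique h2, lambertF]
  field_simp
  ring

/-- Iterates `1/(N² D) = 1/(N² M²) - t²/(M² D)`, where `D = M² + N² t²`. -/
lemma inv_pow_mul_inv_sq_add_sq (k : ℕ) {N M t : ℝ} (hN : 0 < N) (hM : 0 < M) :
    (N ^ (2 * k))⁻¹ * (M ^ 2 + (N * t) ^ 2)⁻¹ =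
      ∑ j ∈ Finset.range k, (-1) ^ j * t ^ (2 * j) *
        ((N ^ (2 * (k - j)))⁻¹ * (M ^ (2 * (j + 1)))⁻¹)
      + (-1) ^ k * t ^ (2 * k) * ((M ^ (2 * k))⁻¹ * (M ^ 2 + (N * t) ^ 2)⁻¹) := by
  induction k with
  | zero => simp
  | succ k ih =>
    have hD : M ^ 2 + (N * t) ^ 2 ≠ 0 := by positivity
    have h1 : (N ^ (2 * (k + 1)))⁻¹ * (M ^ 2 + (N * t) ^ 2)⁻¹ =
        (N ^ 2)⁻¹ * ((N ^ (2 * k))⁻¹ * (M ^ 2 + (N * t) ^ 2)⁻¹) := by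
      rw [Nat.mul_succ, pow_add, mul_inv]; ring
    rw [h1, ih, mul_add, Finset.mul_sum, Finset.sum_range_succ, add_assoc]
    congr 1
    · refine Finset.sum_congr rfl fun j hj => ?_
      have hj' := Finset.mem_range.1 hj
      rw [show 2 * (k + 1 - j) = 2 * (k - j) + 2 by omega, pow_add N, mul_inv]
      ring
    · rw [show k + 1 - k = 1 by omega, mul_add 2 k 1, pow_add t, pow_add M, pow_succ (-1 : ℝ)]
      have hq : M ^ (2 * k) ≠ 0 := by positivity
      generalize M ^ (2 * k) = q at hq
      field_simp
      ring

lemma tsum_latticeTerm_inv {k : ℕ} (hk : 1 ≤ k) {t : ℝ} (ht : 0 < t) :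
    t ^ 2 * ∑' p, latticeTerm k t p =
      ∑ j ∈ Finset.range k, (-1) ^ j * t ^ (2 * j + 2) *
        (zetaSum (2 * (k - j)) * zetaSum (2 * (j + 1)))
      + (-1) ^ k * t ^ (2 * k) * ∑' p, latticeTerm k t⁻¹ p := by
  have hprod : ∀ j ∈ Finset.range k, HasSum (fun p : ℕ × ℕ => (-1) ^ j * t ^ (2 * j + 2) *
      ((((p.1 : ℝ) + 1) ^ (2 * (k - j)))⁻¹ * (((p.2 : ℝ) + 1) ^ (2 * (j + 1)))⁻¹))
      ((-1) ^ j * t ^ (2 * j + 2) * (zetaSum (2 * (k - j)) * zetaSum (2 * (j + 1)))) :=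
    fun j hj => by
      have hj' := Finset.mem_range.1 hj
      exact ((hasSum_zetaSum (by omega)).mul (hasSum_zetaSum (by omega))
        (summable_inv_pow_mul_inv_pow (by omega) (by omega))).mul_left _
  have hswap : HasSum (fun p : ℕ × ℕ => latticeTerm k t⁻¹ p.swap) (∑' p, latticeTerm k t⁻¹ p) :=
    (Equiv.prodComm ℕ ℕ).hasSum_iff.2 (summable_latticeTerm hk t⁻¹).hasSum
  have h := (hasSum_sum hprod).add (hswap.mul_left ((-1) ^ k * t ^ (2 * k)))
  refine ((summable_latticeTerm hk t).hasSum.mul_left (t ^ 2)).unique ?_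
  refine h.congr_of_eq (fun p => ?_) rfl
  have hN : (0 : ℝ) < (p.1 : ℝ) + 1 := by positivity
  have hM : (0 : ℝ) < (p.2 : ℝ) + 1 := by positivity
  rw [latticeTerm, inv_pow_mul_inv_sq_add_sq k hN hM, mul_add, Finset.mul_sum]
  congr 1
  · exact Finset.sum_congr rfl fun j _ => by ring
  · rw [latticeTerm, Prod.fst_swap, Prod.snd_swap]
    have hq : ((p.2 : ℝ) + 1) ^ (2 * k) ≠ 0 := by positivity
    have hD : ((p.2 : ℝ) + 1) ^ 2 + (((p.1 : ℝ) + 1) * t) ^ 2 ≠ 0 := by positivity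
    -- The remainder is the lattice term at `1/t` with indices swapped, up to the factor `t²`.
    have hD' : ((p.1 : ℝ) + 1) ^ 2 + (((p.2 : ℝ) + 1) * t⁻¹) ^ 2 =
      (((p.2 : ℝ) + 1) ^ 2 + (((p.1 : ℝ) + 1) * t) ^ 2) / t ^ 2 := by field_simp; ring
    rw [hD']
    field_simp

/-- Ramanujan's formula for `ζ(2k+1)`, at the points `π t` and `π / t`. -/
lemma ramanujan_formula {k : ℕ} (hk : 1 ≤ k) {t : ℝ} (ht : 0 < t) :
    (zetaSum (2 * k + 1) + 2 * lambertF (2 * k + 1) (Real.pi * t))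
      - (-1) ^ k * t ^ (2 * k) *
        (zetaSum (2 * k + 1) + 2 * lambertF (2 * k + 1) (Real.pi * t⁻¹)) =
    -(2 / Real.pi) * ∑ j ∈ Finset.range (k + 2),
      (-1) ^ j * (evenZeta j * evenZeta (k + 1 - j)) * t ^ (2 * (j : ℤ) - 1) := by
  have hpi := Real.pi_pos
  have h := tsum_latticeTerm_inv hk ht
  rw [zetaSum_add_two_mul_lambertF hk ht, zetaSum_add_two_mul_lambertF hk (inv_pos.2 ht)]
  rw [show 2 * k + 2 = 2 * (k + 1) by ring, zetaSum_even (Nat.succ_ne_zero k)]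
  rw [Finset.sum_range_succ, Finset.sum_range_succ', Nat.sub_zero, Nat.sub_self, evenZeta_zero]
  have hs : ∑ j ∈ Finset.range k, (-1) ^ (j + 1) * (evenZeta (j + 1) * evenZeta (k + 1 - (j + 1)))
      * t ^ (2 * ((j + 1 : ℕ) : ℤ) - 1) = -(t⁻¹ * ∑ j ∈ Finset.range k,
        (-1) ^ j * t ^ (2 * j + 2) * (zetaSum (2 * (k - j)) * zetaSum (2 * (j + 1)))) := by
    rw [Finset.mul_sum, ← Finset.sum_neg_distrib]
    refine Finset.sum_congr rfl fun j hj => ?_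
    have hj' := Finset.mem_range.1 hj
    rw [zetaSum_even (by omega), zetaSum_even (by omega), show k + 1 - (j + 1) = k - j by omega,
      zpow_sub_one₀ ht.ne', show 2 * ((j + 1 : ℕ) : ℤ) = ((2 * j + 2 : ℕ) : ℤ) by push_cast; ring,
      zpow_natCast, pow_succ (-1 : ℝ)]
    ring
  rw [hs, eq_sub_of_add_eq h.symm]
  have e1 : t ^ (2 * ((k + 1 : ℕ) : ℤ) - 1) = t ^ (2 * k) * t := by
    rw [show 2 * ((k + 1 : ℕ) : ℤ) - 1 = ((2 * k + 1 : ℕ) : ℤ) by push_cast; ring, zpow_natCast,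
      pow_succ]
  have e2 : t ^ (2 * ((0 : ℕ) : ℤ) - 1) = t⁻¹ := by norm_num
  rw [e1, e2, pow_succ (-1 : ℝ)]
  field_simp
  ring

/-! ### Euler chains: iterating `(θ + m) / (m + 1)`. -/

/-- With `θ = x d/dx`, the relation `u (m + 1) = (θ + m) (u m) / (m + 1)` on `(0, ∞)`; it says that
`u m` is `θ (θ + 1) ⋯ (θ + m - 1) / m!` applied to `u 0`. -/
def IsEulerChain (u : ℕ → ℝ → ℝ) : Prop :=
  ∀ m : ℕ, ∀ x : ℝ, 0 < x → HasDerivAt (u m) (((m + 1) * u (m + 1) x - m * u m x) / x) x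

namespace IsEulerChain

variable {u v : ℕ → ℝ → ℝ}

lemma add (hu : IsEulerChain u) (hv : IsEulerChain v) :
    IsEulerChain fun m x => u m x + v m x := fun m x hx => by
  refine ((hu m x hx).fun_add (hv m x hx)).congr_deriv ?_
  ring

lemma const_mul (hu : IsEulerChain u) (c : ℝ) : IsEulerChain fun m x => c * u m x :=
  fun m x hx => by
    refine ((hu m x hx).const_mul c).congr_deriv ?_
    ring

lemma sum {ι : Type*} (s : Finset ι) {w : ι → ℕ → ℝ → ℝ} (hw : ∀ i ∈ s, IsEulerChain (w i)) :
    IsEulerChain fun m x => ∑ i ∈ s, w i m x := fun m x hx => by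
  refine (HasDerivAt.fun_sum fun i hi => hw i hi m x hx).congr_deriv ?_
  rw [← Finset.sum_div, Finset.sum_sub_distrib, Finset.mul_sum, Finset.mul_sum]

/-- Equality at order `m` on the open half-line gives equal derivatives there, and these determine
order `m + 1`. -/
lemma eq_of_eq_zero (hu : IsEulerChain u) (hv : IsEulerChain v)
    (h0 : ∀ x : ℝ, 0 < x → u 0 x = v 0 x) (m : ℕ) : ∀ x : ℝ, 0 < x → u m x = v m x := by
  induction m with
  | zero => exact h0
  | succ m ih =>
    intro x hx
    have h := (hu m x hx).unique ((hv m x hx).congr_of_eventuallyEq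
      (Filter.eventually_of_mem (Ioi_mem_nhds hx) ih))
    rw [div_left_inj' hx.ne', ih x hx, sub_left_inj] at h
    exact mul_left_cancel₀ (by positivity) h

/-- The hypothesis `hT` reads `θ T_r = l_r T_r + e T_{r+1}`, so applying `θ + m` to a combination of
the `T_r` amounts to a recurrence on its coefficients. -/
lemma sum_range_of_recurrence {T : ℕ → ℝ → ℝ} {l : ℕ → ℝ} {e : ℝ} {γ : ℕ → ℕ → ℝ}
    (hT : ∀ r x, 0 < x → HasDerivAt (T r) ((l r * T r x + e * T (r + 1) x) / x) x)
    (h0 : ∀ m : ℕ, (m + 1) * γ (m + 1) 0 = (m + l 0) * γ m 0)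
    (hs : ∀ m r : ℕ, r ≤ m →
      (m + 1) * γ (m + 1) (r + 1) = (m + l (r + 1)) * γ m (r + 1) + e * γ m r)
    (htop : ∀ m, γ m (m + 1) = 0) :
    IsEulerChain fun m x => ∑ r ∈ Finset.range (m + 1), γ m r * T r x := fun m x hx => by
  refine (HasDerivAt.fun_sum fun r _ => (hT r x hx).const_mul (γ m r)).congr_deriv ?_
  have h1 : (m + 1 : ℝ) * ∑ r ∈ Finset.range (m + 1 + 1), γ (m + 1) r * T r x =
      ∑ r ∈ Finset.range (m + 1), (m + l r) * γ m r * T r x +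
        ∑ r ∈ Finset.range (m + 1), e * γ m r * T (r + 1) x := by
    have h2 : ∑ r ∈ Finset.range (m + 1), (m + l r) * γ m r * T r x =
        ∑ r ∈ Finset.range (m + 1 + 1), (m + l r) * γ m r * T r x := by
      rw [Finset.sum_range_succ _ (m + 1), htop]
      ring
    rw [h2, Finset.sum_range_succ', Finset.sum_range_succ' _ (m + 1), mul_add, Finset.mul_sum,
      ← mul_assoc, h0, add_right_comm, ← Finset.sum_add_distrib]
    congr 1
    refine Finset.sum_congr rfl fun r hr => ?_
    rw [← mul_assoc, hs m r (Nat.lt_succ_iff.1 (Finset.mem_range.1 hr))]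
    ring
  rw [h1, Finset.mul_sum, add_sub_right_comm, ← Finset.sum_sub_distrib, ← Finset.sum_add_distrib,
    Finset.sum_div]
  exact Finset.sum_congr rfl fun r _ => by ring

end IsEulerChain

/-! ### Chains of powers, of `F(x)` and of its inversion. -/

/-- Absorption for a generalized binomial: integer `p` is needed because the exponent `2q - 1` is
`-1` at `q = 0`. -/
lemma Ring.succ_mul_choose_add (p : ℤ) (m : ℕ) :
    (m + 1 : ℤ) * Ring.choose (p - 1 + (m + 1 : ℕ)) (m + 1) =
      (p + m) * Ring.choose (p - 1 + m) m := by
  have h := Ring.choose_smul_choose (p - 1 + (m + 1 : ℕ)) (Nat.le_add_left 1 m)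
  rw [Nat.choose_one_right, Ring.choose_one_right, Nat.add_sub_cancel, nsmul_eq_mul] at h
  have e1 : p - 1 + (m + 1 : ℕ) = p + m := by push_cast; ring
  have e2 : p + (m : ℤ) - 1 = p - 1 + m := by ring
  rw [e1, Nat.cast_one, e2] at h
  rw [e1]
  exact_mod_cast h

lemma hasDerivAt_div_zpow {c x : ℝ} (hc : 0 < c) (hx : 0 < x) (p : ℤ) :
    HasDerivAt (fun x => (x / c) ^ p) (p * (x / c) ^ p / x) x := by
  have h := (hasDerivAt_zpow p (x / c) (Or.inl (div_pos hx hc).ne')).comp x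
    ((hasDerivAt_id x).div_const c)
  refine h.congr_deriv ?_
  rw [zpow_sub_one₀ (div_pos hx hc).ne']
  field_simp

lemma isEulerChain_zpow {c : ℝ} (hc : 0 < c) (p : ℤ) :
    IsEulerChain fun m x => ((Ring.choose (p - 1 + (m : ℤ)) m : ℤ) : ℝ) * (x / c) ^ p :=
  fun m x hx => by
    refine ((hasDerivAt_div_zpow hc hx p).const_mul _).congr_deriv ?_
    have h : ((m : ℝ) + 1) * ((Ring.choose (p - 1 + ((m + 1 : ℕ) : ℤ)) (m + 1) : ℤ) : ℝ) =
        (p + m) * ((Ring.choose (p - 1 + (m : ℤ)) m : ℤ) : ℝ) := by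
      exact_mod_cast Ring.succ_mul_choose_add p m
    rw [← mul_assoc, h]
    ring

/-- The coefficient of `x ^ r (d/dx) ^ r` in `θ (θ + 1) ⋯ (θ + m - 1) / m!`. -/
noncomputable def eulerCoeff : ℕ → ℕ → ℝ
  | 0, 0 => 1
  | 0, _ + 1 => 0
  | _ + 1, 0 => 0
  | m + 1, r + 1 => 1 / ((r + 1).factorial : ℝ) * (m.choose r : ℝ)

lemma eulerCoeff_recurrence {m r : ℕ} (hr : r ≤ m) :
    ((m : ℝ) + 1) * eulerCoeff (m + 1) (r + 1) =
      (m + ((r + 1 : ℕ) : ℝ)) * eulerCoeff m (r + 1) + 1 * eulerCoeff m r := by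
  rcases m with _ | m
  · obtain rfl := Nat.le_zero.1 hr
    simp [eulerCoeff]
  rcases r with _ | r
  · simp [eulerCoeff]
  have hr' : r ≤ m := by omega
  have h := Nat.choose_succ_right_eq m r
  have h' : (m.choose (r + 1) : ℝ) * (r + 1) = m.choose r * (m - r) := by
    rw [← Nat.cast_sub hr']
    exact_mod_cast h
  simp only [eulerCoeff, Nat.choose_succ_succ' m r, Nat.factorial_succ (r + 1)]
  have hf : ((r + 1).factorial : ℝ) ≠ 0 := by positivity
  push_cast
  field_simp
  linear_combination -h'

lemma isEulerChain_iteratedDeriv {G : ℕ → ℝ → ℝ}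
    (hG : ∀ r x, 0 < x → HasDerivAt (G r) (G (r + 1) x) x) :
    IsEulerChain fun m x => ∑ r ∈ Finset.range (m + 1), eulerCoeff m r * (x ^ r * G r x) := by
  refine IsEulerChain.sum_range_of_recurrence (l := fun r => r) (e := 1)
    (T := fun r x => x ^ r * G r x) (fun r x hx => ?_) (fun m => ?_)
    (fun m r hr => eulerCoeff_recurrence hr) (fun m => ?_)
  · refine ((hasDerivAt_pow r x).mul (hG r x hx)).congr_deriv ?_
    rcases r with _ | r
    · simp
      field_simp
    · simp only [Nat.add_sub_cancel, pow_succ]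
      field_simp
  · rcases m with _ | m <;> simp [eulerCoeff]
  · rcases m with _ | m <;> simp [eulerCoeff]

lemma succ_mul_choose_add_succ (n m : ℕ) :
    ((m : ℝ) + 1) * ((n + m + 1).choose n : ℝ) = (m + n + 1) * ((n + m).choose n : ℝ) := by
  have h := Nat.choose_mul_succ_eq (n + m) n
  rw [show n + m + 1 - n = m + 1 by omega] at h
  have h' : ((n + m).choose n : ℝ) * (n + m + 1) = (n + m + 1).choose n * (m + 1) := by
    exact_mod_cast h
  linear_combination -h'

/-- Under `x ↦ d/x` the operator `θ` changes sign, so `l_r = n + 1 - r` and `e = -1`; the summand `n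
+ 1` comes from the prefactor. -/
lemma isEulerChain_iteratedDeriv_inv {G : ℕ → ℝ → ℝ}
    (hG : ∀ r x, 0 < x → HasDerivAt (G r) (G (r + 1) x) x) {n : ℕ} (hn : n ≠ 0) {c d : ℝ}
    (hc : 0 < c) (hd : 0 < d) :
    IsEulerChain fun m x => ∑ r ∈ Finset.range (m + 1),
      (-1) ^ r / (r.factorial : ℝ) * ((n + m - r).choose n : ℝ) *
        ((x / c) ^ (n + 1) * ((d / x) ^ r * G r (d / x))) := by
  refine IsEulerChain.sum_range_of_recurrence (l := fun r => (n : ℝ) + 1 - r) (e := -1)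
    (T := fun r x => (x / c) ^ (n + 1) * ((d / x) ^ r * G r (d / x)))
    (γ := fun m r => (-1) ^ r / (r.factorial : ℝ) * ((n + m - r).choose n : ℝ))
    (fun r x hx => ?_) (fun m => ?_) (fun m r hr => ?_) (fun m => ?_)
  · have hq : HasDerivAt (fun x => d / x) (-(d / x) / x) x := by
      refine ((hasDerivAt_inv hx.ne').const_mul d).congr_deriv ?_
      field_simp
    have h1 : HasDerivAt (fun x => (x / c) ^ (n + 1)) ((n + 1) * (x / c) ^ (n + 1) / x) x := by
      have := hasDerivAt_div_zpow hc hx ((n + 1 : ℕ) : ℤ)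
      simp only [zpow_natCast, Int.cast_natCast] at this
      exact_mod_cast this
    have h2 := (hasDerivAt_pow r (d / x)).comp x hq
    have h3 := (hG r (d / x) (div_pos hd hx)).comp x hq
    refine (h1.mul (h2.mul h3)).congr_deriv ?_
    simp only [Function.comp_apply, Pi.mul_apply]
    have hq0 : d / x ≠ 0 := (div_pos hd hx).ne'
    generalize d / x = q at hq0
    generalize (x / c) ^ (n + 1) = w
    rcases r with _ | r
    · simp
      ring
    · simp only [Nat.add_sub_cancel, pow_succ]
      push_cast
      field_simp
      ring
  · simp only [pow_zero, Nat.factorial_zero, Nat.cast_one, Nat.cast_zero, Nat.sub_zero, div_one,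
      one_mul, sub_zero]
    rw [← Nat.add_assoc, succ_mul_choose_add_succ]
    ring
  · have hf : (r.factorial : ℝ) ≠ 0 := by positivity
    have key : ((m : ℝ) - r) * ((n + m - r).choose n : ℝ) =
        (m + n - r) * ((n + m - (r + 1)).choose n : ℝ) := by
      obtain ⟨i, rfl⟩ := Nat.exists_eq_add_of_le hr
      rcases i with _ | i
      · rw [Nat.choose_eq_zero_of_lt (show n + (r + 0) - (r + 1) < n by omega)]
        simp
      · rw [show n + (r + (i + 1)) - r = n + i + 1 by omega,
          show n + (r + (i + 1)) - (r + 1) = n + i by omega]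
        have := succ_mul_choose_add_succ n i
        push_cast
        linear_combination this
    rw [show n + (m + 1) - (r + 1) = n + m - r by omega, Nat.factorial_succ, pow_succ (-1 : ℝ)]
    push_cast
    field_simp
    linear_combination -key
  · rw [Nat.choose_eq_zero_of_lt (by omega)]
    simp

lemma sum_eulerCoeff_eq {m : ℕ} (hm : 1 ≤ m) (w : ℕ → ℝ) :
    ∑ r ∈ Finset.range (m + 1), eulerCoeff m r * w r = 1 / (m.factorial : ℝ) * w m +
      ∑ r ∈ Finset.Icc 1 (m - 1), 1 / (r.factorial : ℝ) * ((m - 1).choose (r - 1) : ℝ) * w r := by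
  obtain ⟨i, rfl⟩ := Nat.exists_eq_add_of_le' hm
  have hI : Finset.Icc 1 (i + 1 - 1) = Finset.Ico 1 (i + 1) := by
    ext r
    simp only [Finset.mem_Icc, Finset.mem_Ico]
    omega
  rw [hI, Finset.sum_Ico_eq_sum_range, Finset.sum_range_succ', Finset.sum_range_succ]
  simp only [eulerCoeff, Nat.add_sub_cancel, Nat.choose_self, Nat.cast_one, mul_one, zero_mul,
    add_zero, Nat.add_comm 1]
  ring

/-! ### Bernoulli numbers and the identities of order `m`. -/

lemma evenZeta_mul_evenZeta {k j : ℕ} (hj : j ≤ k + 1) :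
    evenZeta j * evenZeta (k + 1 - j) = (-1) ^ (k + 1) * (2 * Real.pi) ^ (2 * k + 2) / 4 *
      ((bernoulli (2 * j) : ℝ) * (bernoulli (2 * (k + 1 - j)) : ℝ) /
        (((2 * j).factorial : ℝ) * ((2 * (k + 1 - j)).factorial : ℝ))) := by
  obtain ⟨i, hi⟩ := Nat.exists_eq_add_of_le hj
  have e : k + 1 - j = i := by omega
  rw [e, show 2 * k + 2 = 2 * j + 2 * i by omega, hi, evenZeta, evenZeta, pow_add (2 * Real.pi),
    pow_add (-1 : ℝ) j i, pow_succ (-1 : ℝ), pow_succ (-1 : ℝ)]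
  field_simp
  ring

/-- Ramanujan's formula in the variable `x`, with explicit Bernoulli numbers. -/
lemma ramanujan_formula' {k : ℕ} (hk : 1 ≤ k) {x : ℝ} (hx : 0 < x) :
    (zetaSum (2 * k + 1) + 2 * lambertF (2 * k + 1) x)
      - (-1) ^ k * (x / Real.pi) ^ (2 * k) *
        (zetaSum (2 * k + 1) + 2 * lambertF (2 * k + 1) (Real.pi ^ 2 / x)) =
    (2 * Real.pi) ^ (2 * k + 1) * ∑ q ∈ Finset.range (k + 2), (-1) ^ (k + q)
      * ((bernoulli (2 * q) : ℝ) * (bernoulli (2 * (k + 1 - q)) : ℝ)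
        / (((2 * q).factorial : ℝ) * ((2 * (k + 1 - q)).factorial : ℝ)))
      * (x / Real.pi) ^ (2 * (q : ℤ) - 1) := by
  have hpi := Real.pi_pos
  have h := ramanujan_formula hk (div_pos hx hpi)
  rw [show Real.pi * (x / Real.pi) = x by field_simp,
    show Real.pi * (x / Real.pi)⁻¹ = Real.pi ^ 2 / x by field_simp] at h
  rw [h, Finset.mul_sum, Finset.mul_sum]
  refine Finset.sum_congr rfl fun q hq => ?_
  rw [evenZeta_mul_evenZeta (Nat.lt_succ_iff.1 (Finset.mem_range.1 hq)), pow_succ (-1 : ℝ),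
    pow_succ (2 * Real.pi) (2 * k + 1), pow_add (-1 : ℝ) k q]
  field_simp
  ring

lemma ramanujan_formula_derivatives {k : ℕ} (hk : 1 ≤ k) {m : ℕ} (hm : 1 ≤ m) {x : ℝ}
    (hx : 0 < x) :
    (-1) ^ k * ((2 * k - 1 + m).choose m : ℝ) * (x / Real.pi) ^ (2 * k) * zetaSum (2 * k + 1)
      + (2 * Real.pi) ^ (2 * k + 1) * ∑ q ∈ Finset.range (k + 2), (-1) ^ (k + q)
        * ((bernoulli (2 * q) : ℝ) * (bernoulli (2 * (k + 1 - q)) : ℝ)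
          / (((2 * q).factorial : ℝ) * ((2 * (k + 1 - q)).factorial : ℝ)))
        * ((Ring.choose (2 * ((q : ℤ) - 1) + (m : ℤ)) m : ℤ) : ℝ)
        * (x / Real.pi) ^ (2 * (q : ℤ) - 1) =
    2 * (∑ r ∈ Finset.range (m + 1),
        eulerCoeff m r * (x ^ r * iteratedDeriv r (lambertF (2 * k + 1)) x))
      - 2 * (-1) ^ k * (x / Real.pi) ^ (2 * k) * ∑ r ∈ Finset.range (m + 1),
        (-1) ^ r / (r.factorial : ℝ) * ((2 * k - 1 + m - r).choose (2 * k - 1) : ℝ)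
          * ((Real.pi ^ 2 / x) ^ r
            * iteratedDeriv r (lambertF (2 * k + 1)) (Real.pi ^ 2 / x)) := by
  have hpi := Real.pi_pos
  have hG : ∀ r x, 0 < x → HasDerivAt (iteratedDeriv r (lambertF (2 * k + 1)))
      (iteratedDeriv (r + 1) (lambertF (2 * k + 1)) x) x := fun r x hx =>
    hasDerivAt_iteratedDeriv_lambertF (by omega) r hx
  have hn : 2 * k - 1 + 1 = 2 * k := by omega
  -- The constant `ζ(2k+1)` enters as a power of exponent `0`; its later terms vanish by `c0`, so
  -- only the zeta term with `x^{2k}` survives.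
  have hL := (((isEulerChain_zpow hpi 0).const_mul (zetaSum (2 * k + 1))).add
    ((isEulerChain_iteratedDeriv hG).const_mul 2)).add
      ((((isEulerChain_zpow hpi (2 * k : ℕ)).const_mul (zetaSum (2 * k + 1))).add
        ((isEulerChain_iteratedDeriv_inv hG (n := 2 * k - 1) (by omega) hpi
          (pow_pos hpi 2)).const_mul 2)).const_mul (-(-1) ^ k))
  have hR := (IsEulerChain.sum (Finset.range (k + 2)) (fun q _ =>
    (isEulerChain_zpow hpi (2 * (q : ℤ) - 1)).const_mul ((-1) ^ (k + q)
      * ((bernoulli (2 * q) : ℝ) * (bernoulli (2 * (k + 1 - q)) : ℝ)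
        / (((2 * q).factorial : ℝ) * ((2 * (k + 1 - q)).factorial : ℝ)))))).const_mul
    ((2 * Real.pi) ^ (2 * k + 1))
  have h := hL.eq_of_eq_zero hR (fun y hy => ?_) m x hx
  · have c0 : Ring.choose (0 - 1 + (m : ℤ)) m = 0 := by
      rw [show (0 - 1 + (m : ℤ)) = ((m - 1 : ℕ) : ℤ) by push_cast [hm]; ring, Ring.choose_natCast,
        Nat.choose_eq_zero_of_lt (by omega), Nat.cast_zero]
    have c1 : Ring.choose (((2 * k : ℕ) : ℤ) - 1 + (m : ℤ)) m = ((2 * k - 1 + m).choose m : ℕ) := by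
      rw [← Ring.choose_natCast]
      congr 1
      omega
    have hs : ∀ q : ℕ, (2 * (q : ℤ) - 1 - 1 + (m : ℤ)) = 2 * ((q : ℤ) - 1) + m := fun q => by ring
    simp only [c0, c1, hs, hn, zpow_natCast, Int.cast_zero, zero_mul, mul_zero, zero_add,
      Int.cast_natCast] at h
    have e1 : ∀ u : ℕ → ℝ, ∀ v : ℕ → ℝ, ∑ r ∈ Finset.range (m + 1),
        u r * ((x / Real.pi) ^ (2 * k) * v r) =
        (x / Real.pi) ^ (2 * k) * ∑ r ∈ Finset.range (m + 1), u r * v r := fun u v => by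
      rw [Finset.mul_sum]
      exact Finset.sum_congr rfl fun r _ => by ring
    rw [e1] at h
    simp only [← mul_assoc] at h ⊢
    linear_combination -h
  · have h := ramanujan_formula' hk hy
    simp only [Ring.choose_zero_right, Int.cast_one, one_mul, zero_add, Finset.range_one,
      Finset.sum_singleton, eulerCoeff, pow_zero, iteratedDeriv_zero, zpow_zero, hn,
      Nat.factorial_zero, Nat.cast_one, div_one, Nat.add_zero, Nat.sub_zero, Nat.choose_self,
      zpow_natCast, mul_one]
    rw [← h]
    ring

theorem mainTheorem1 (a b : ℝ) (ha : 0 < a) (hb : 0 < b) (hab : a * b = Real.pi ^ 2)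
    (k : ℕ) (hk : 1 ≤ k) :
    -- the series converges on `(0, ∞)` and defines a smooth function there
    (∀ x : ℝ, 0 < x → Summable (lambertTerm (2 * k + 1) x)) ∧
    ContDiffOn ℝ (⊤ : ℕ∞) (lambertF (2 * k + 1)) (Set.Ioi 0) ∧
    -- order zero: Ramanujan's formula
    ((a ^ (-(k : ℤ)) : ℝ) : ℂ) *
          (riemannZeta (2 * (k : ℂ) + 1) / 2 + ((lambertF (2 * k + 1) a : ℝ) : ℂ))
        = (((-b) ^ (-(k : ℤ)) : ℝ) : ℂ) *
            (riemannZeta (2 * (k : ℂ) + 1) / 2 + ((lambertF (2 * k + 1) b : ℝ) : ℂ))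
          - ((2 ^ (2 * k) * ∑ j ∈ Finset.range (k + 2),
              (-1) ^ j * (bernoulli (2 * j) : ℝ) * (bernoulli (2 * k + 2 - 2 * j) : ℝ)
                / (((2 * j).factorial : ℝ) * ((2 * k + 2 - 2 * j).factorial : ℝ))
                * a ^ (k + 1 - j) * b ^ j : ℝ) : ℂ) ∧
    -- order `m ≥ 1`
    ∀ m : ℕ, 1 ≤ m →
      (((-1) ^ k * ((2 * k - 1 + m).choose m : ℝ) * (Real.pi / a) ^ (2 * k) : ℝ) : ℂ)
            * riemannZeta (2 * (k : ℂ) + 1)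
          + (((2 * Real.pi) ^ (2 * k + 1) * ∑ q ∈ Finset.range (k + 2),
              (-1) ^ (k + q)
                * ((bernoulli (2 * q) : ℝ) * (bernoulli (2 * (k + 1 - q)) : ℝ)
                  / (((2 * q).factorial : ℝ) * ((2 * (k + 1 - q)).factorial : ℝ)))
                * ((Ring.choose (2 * ((q : ℤ) - 1) + (m : ℤ)) m : ℤ) : ℝ)
                * (Real.pi / a) ^ (2 * (q : ℤ) - 1) : ℝ) : ℂ)
        = ((2 * (b ^ m / (m.factorial : ℝ)) * iteratedDeriv m (lambertF (2 * k + 1)) b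
            + 2 * ∑ r ∈ Finset.Icc 1 (m - 1),
                1 / (r.factorial : ℝ) * ((m - 1).choose (r - 1) : ℝ)
                  * b ^ r * iteratedDeriv r (lambertF (2 * k + 1)) b
            + 2 * (-1) ^ k * (Real.pi / a) ^ (2 * k) * ∑ r ∈ Finset.range (m + 1),
                (-1) ^ (r + 1) / (r.factorial : ℝ)
                  * ((2 * k - 1 + m - r).choose (2 * k - 1) : ℝ)
                  * a ^ r * iteratedDeriv r (lambertF (2 * k + 1)) a : ℝ) : ℂ) := by
  have hpi := Real.pi_pos
  have hba : Real.pi ^ 2 / b = a := by rw [← hab]; field_simp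
  have hbp : b / Real.pi = Real.pi / a := by
    rw [div_eq_div_iff hpi.ne' ha.ne', mul_comm b a, hab, sq]
  refine ⟨fun x hx => summable_lambertTerm (by omega) hx, fun x hx =>
    (contDiffAt_lambertF (by omega) hx).contDiffWithinAt, ?_, fun m hm => ?_⟩
  · rw [riemannZeta_eq_zetaSum hk]
    have h := ramanujan_formula' hk hb
    rw [hba] at h
    -- Order zero is the formula at `x = b` divided by `(-b)^k`; the factor `2` arises because it
    -- involves `ζ + 2F` instead of `ζ/2 + F`.
    have hs : (-b) ^ (-(k : ℤ)) * ((2 * Real.pi) ^ (2 * k + 1) * ∑ q ∈ Finset.range (k + 2),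
        (-1) ^ (k + q) * ((bernoulli (2 * q) : ℝ) * (bernoulli (2 * (k + 1 - q)) : ℝ)
        / (((2 * q).factorial : ℝ) * ((2 * (k + 1 - q)).factorial : ℝ)))
        * (b / Real.pi) ^ (2 * (q : ℤ) - 1)) =
        2 * (2 ^ (2 * k) * ∑ j ∈ Finset.range (k + 2),
              (-1) ^ j * (bernoulli (2 * j) : ℝ) * (bernoulli (2 * k + 2 - 2 * j) : ℝ)
                / (((2 * j).factorial : ℝ) * ((2 * k + 2 - 2 * j).factorial : ℝ))
                * a ^ (k + 1 - j) * b ^ j) := by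
      simp only [Finset.mul_sum]
      refine Finset.sum_congr rfl fun q hq => ?_
      have hq' := Finset.mem_range.1 hq
      obtain ⟨i, hi⟩ := Nat.exists_eq_add_of_le (Nat.lt_succ_iff.1 hq')
      rw [show 2 * k + 2 - 2 * q = 2 * (k + 1 - q) by omega, ← hba, zpow_sub_one₀ (by positivity),
        show (2 * (q : ℤ)) = ((2 * q : ℕ) : ℤ) by push_cast; ring, zpow_natCast, zpow_neg,
        zpow_natCast, neg_pow, pow_add (-1 : ℝ) k q]
      have e1 : Real.pi ^ (2 * k + 1) * (b / Real.pi) ^ (2 * q) * (b / Real.pi)⁻¹ =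
          b ^ k * ((Real.pi ^ 2 / b) ^ (k + 1 - q) * b ^ q) := by
        rw [show k + 1 - q = i by omega, div_pow, div_pow]
        have e2 : b ^ k * b = b ^ q * b ^ i := by rw [← pow_succ, ← pow_add, hi]
        have e3 : Real.pi ^ (2 * k + 1) * Real.pi = Real.pi ^ (2 * q) * (Real.pi ^ 2) ^ i := by
          rw [← pow_succ, ← pow_mul, ← pow_add]
          congr 1
          omega
        field_simp
        rw [pow_mul b 2 q]
        linear_combination (b ^ q * b ^ q * b ^ i) * e3 -
          (Real.pi ^ (2 * q) * (Real.pi ^ 2) ^ i * b ^ q) * e2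
      have e4 : ((-1 : ℝ) ^ k)⁻¹ * (-1) ^ k = 1 := inv_mul_cancel₀ (by positivity)
      have e5 : (b ^ k)⁻¹ * b ^ k = 1 := inv_mul_cancel₀ (by positivity)
      rw [mul_pow, pow_succ (2 : ℝ), mul_inv, mul_assoc _ ((Real.pi ^ 2 / b) ^ (k + 1 - q)) (b ^ q)]
      -- Powers become atoms, leaving an identity that follows linearly from `e1`, `e4` and `e5`.
      generalize (Real.pi ^ 2 / b) ^ (k + 1 - q) * b ^ q = Q at e1 ⊢
      generalize ((-1 : ℝ) ^ k)⁻¹ = s at e4 ⊢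
      generalize (b ^ k)⁻¹ = w at e5 ⊢
      generalize (b / Real.pi) ^ (2 * q) = X at e1 ⊢
      generalize (b / Real.pi)⁻¹ = Y at e1 ⊢
      generalize Real.pi ^ (2 * k + 1) = P at e1 ⊢
      generalize (-1 : ℝ) ^ k = σ at e4 ⊢
      rw [← mul_div_assoc]
      generalize ((2 * q).factorial : ℝ) * ((2 * (k + 1 - q)).factorial : ℝ) = F
      linear_combination (2 * 2 ^ (2 * k) * (-1) ^ q * (bernoulli (2 * q) : ℝ) *
        (bernoulli (2 * (k + 1 - q)) : ℝ) / F) * (s * σ * w * e1 + Q * s * σ * e5 + Q * e4)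
    have hneg : (-b) ^ (-(k : ℤ)) * ((-1) ^ k * (b / Real.pi) ^ (2 * k)) = a ^ (-(k : ℤ)) := by
      rw [zpow_neg, zpow_neg, zpow_natCast, zpow_natCast, neg_pow, ← hba, pow_mul, div_pow,
        div_pow, div_pow]
      field_simp
      exact pow_right_comm b 2 k
    rw [← h] at hs
    have key : a ^ (-(k : ℤ)) * (zetaSum (2 * k + 1) / 2 + lambertF (2 * k + 1) a) =
        (-b) ^ (-(k : ℤ)) * (zetaSum (2 * k + 1) / 2 + lambertF (2 * k + 1) b) -
        2 ^ (2 * k) * ∑ j ∈ Finset.range (k + 2),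
              (-1) ^ j * (bernoulli (2 * j) : ℝ) * (bernoulli (2 * k + 2 - 2 * j) : ℝ)
                / (((2 * j).factorial : ℝ) * ((2 * k + 2 - 2 * j).factorial : ℝ))
                * a ^ (k + 1 - j) * b ^ j := by
      rw [← hneg]
      linear_combination (-1 / 2 : ℝ) * hs
    exact_mod_cast congrArg (fun y : ℝ => (y : ℂ)) key
  · rw [riemannZeta_eq_zetaSum hk, ← Complex.ofReal_mul, ← Complex.ofReal_add, Complex.ofReal_inj,
      ← hbp, ramanujan_formula_derivatives hk hm hb, sum_eulerCoeff_eq hm, hba]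
    have e1 : ∑ r ∈ Finset.range (m + 1), (-1) ^ (r + 1) / (r.factorial : ℝ)
        * ((2 * k - 1 + m - r).choose (2 * k - 1) : ℝ)
        * a ^ r * iteratedDeriv r (lambertF (2 * k + 1)) a =
      -∑ r ∈ Finset.range (m + 1), (-1) ^ r / (r.factorial : ℝ)
        * ((2 * k - 1 + m - r).choose (2 * k - 1) : ℝ)
        * (a ^ r * iteratedDeriv r (lambertF (2 * k + 1)) a) := by
      rw [← Finset.sum_neg_distrib]
      exact Finset.sum_congr rfl fun r _ => by rw [pow_succ]; ring
    rw [e1]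
    simp only [← mul_assoc]
    ring
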